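/- For $x,\xi\in\mathbb R$ write $T_xf(t)=f(t-x)$ and $M_\xi f(t)=e^{2\pi i\xi t}f(t)$. Let $c<d$ and let $g\in L^2(\mathbb R)$ be complex-valued with $\operatorname{supp}(g)\subseteq[c,d]$, where supports are understood up to null sets (so $\operatorname{supp}(f)\subseteq M$ means $f=0$ a.e. outside $M$). Let $a\in\left[\frac{d-c}{2},\,d-c\right)$, $b\in\left(0,\frac1a\right)$ and $K=\left\lfloor\frac{(d-c-a)b}{1-ab}\right\rfloor$. For $n\in\mathbb Z$ and integers $k\ge1$ put $$I_{n,0}=[c,d]+na,\qquad I^+_{n,k}=[\,c-(k-1)a+kb^{-1},\,d\,]+na,\qquad I^-_{n,k}=[\,c,\,d+(k-1)a-kb^{-1}\,]+na,$$ where $[x,y]=\emptyset$ if $x>y$. Suppose that the Gabor system $\mathcal G(g,a,b)=(M_{mb}T_{na}g)_{m,n\in\mathbb Z}$ is a frame for $L^2(\mathbb R)$, and let $S$, $Sf=\sum_{m,n\in\mathbb Z}\langle f,M_{mb}T_{na}g\rangle M_{mb}T_{na}g$, be its (bounded and boundedly invertible) frame operator. Then: (i) There are functions $\omega_k\in L^\infty(\mathbb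 R)$, $-K\le k\le K$, such that $$S^{-1}f=\sum_{k=-K}^{K}\omega_k\,T_{-kb^{-1}}f\qquad\text{for all } f\in L^2(\mathbb R),$$ and, for $1\le k\le K$, $\operatorname{supp}(\omega_k)\subseteq\bigcup_{n\in\mathbb Z}I^-_{n,k}$ and $\operatorname{supp}(\omega_{-k})\subseteq\bigcup_{n\in\mathbb Z}I^+_{n,k}$. (ii) The canonical dual window $\tilde g=S^{-1}g$ satisfies $$\operatorname{supp}(\tilde g)\subseteq I_{0,0}\cup\bigcup_{k=1}^{K}\left(I^-_{-k,k}\cup I^+_{k,k}\right).$$ -/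

import Mathlib

open MeasureTheory
open scoped ENNReal InnerProductSpace

/-- Translation `T_x f (t) = f (t - x)`. -/
def timeShift (x : ℝ) (f : ℝ → ℂ) : ℝ → ℂ := fun t => f (t - x)

/-- Modulation `M_ω f (t) = f t * e^{2πiωt}`. -/
noncomputable def freqShift (ω : ℝ) (f : ℝ → ℂ) : ℝ → ℂ :=
  fun t => f t * Complex.exp (((2 * Real.pi * ω * t : ℝ) : ℂ) * Complex.I)

theorem memLp_timeShift {f : ℝ → ℂ} (hf : MemLp f 2 volume) (x : ℝ) :
    MemLp (timeShift x f) 2 volume :=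
  hf.comp_measurePreserving (measurePreserving_sub_right volume x)

theorem memLp_freqShift {f : ℝ → ℂ} (hf : MemLp f 2 volume) (ω : ℝ) :
    MemLp (freqShift ω f) 2 volume := by
  have hc : Continuous fun t : ℝ =>
      Complex.exp (((2 * Real.pi * ω * t : ℝ) : ℂ) * Complex.I) := by fun_prop
  refine hf.of_le (hf.1.mul hc.aestronglyMeasurable) (Filter.Eventually.of_forall fun t => ?_)
  simp only [freqShift, norm_mul, Complex.norm_exp_ofReal_mul_I, mul_one, le_refl]

/-- The Gabor system `G(g,a,b)`, i.e. the family `g_{m,n} = M_{mb} T_{na} g` in `L²(ℝ)`,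
indexed by `(m, n) ∈ ℤ × ℤ`. -/
noncomputable def gaborSystem (g : Lp ℂ 2 (volume : Measure ℝ)) (a b : ℝ) :
    ℤ × ℤ → Lp ℂ 2 (volume : Measure ℝ) :=
  fun p => (memLp_freqShift (memLp_timeShift (Lp.memLp g) (p.2 * a)) (p.1 * b)).toLp
    (freqShift (p.1 * b) (timeShift (p.2 * a) g))

/-- `φ` is a frame for `H`: `A‖f‖² ≤ ∑ |⟨f, φ_i⟩|² ≤ B‖f‖²` for some `0 < A ≤ B < ∞`. -/
def IsFrame {ι H : Type*} [NormedAddCommGroup H] [InnerProductSpace ℂ H] (φ : ι → H) : Prop :=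
  ∃ A B : ℝ, 0 < A ∧ A ≤ B ∧ ∀ f : H,
    Summable (fun i => ‖⟪φ i, f⟫_ℂ‖ ^ 2) ∧
    A * ‖f‖ ^ 2 ≤ ∑' i, ‖⟪φ i, f⟫_ℂ‖ ^ 2 ∧
    ∑' i, ‖⟪φ i, f⟫_ℂ‖ ^ 2 ≤ B * ‖f‖ ^ 2

/-- `S` is the frame operator of `φ`: `S f = ∑ ⟨f, φ_i⟩ φ_i` for every `f`, with unconditional
convergence in `H`. There is at most one such `S`. (Mathlib's inner product is linear in the
second argument.) -/
def IsFrameOperator {ι H : Type*} [NormedAddCommGroup H] [InnerProductSpace ℂ H]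
    (φ : ι → H) (S : H → H) : Prop :=
  ∀ f : H, HasSum (fun i => ⟪φ i, f⟫_ℂ • φ i) (S f)

/-- `supp f ⊆ M` for the essential support, i.e. the support up to null sets: `f` vanishes
almost everywhere outside `M`. -/
def EssSuppSubset (f : ℝ → ℂ) (M : Set ℝ) : Prop :=
  ∀ᵐ t ∂(volume : Measure ℝ), t ∉ M → f t = 0

/-- `I⁺_{n,k} = [c - (k-1)a + k/b, d] + na`, empty if the left end exceeds the right end. -/
noncomputable def intervalPlus (a b c d : ℝ) (n : ℤ) (k : ℕ) : Set ℝ :=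
  Set.Icc (c - ((k : ℝ) - 1) * a + k * b⁻¹ + n * a) (d + n * a)

/-- `I⁻_{n,k} = [c, d + (k-1)a - k/b] + na`, empty if the left end exceeds the right end. -/
noncomputable def intervalMinus (a b c d : ℝ) (n : ℤ) (k : ℕ) : Set ℝ :=
  Set.Icc (c + n * a) (d + ((k : ℝ) - 1) * a - k * b⁻¹ + n * a)

/-! Write β = 1/b. The frame operator S commutes with the modulations by multiples of b, hence with
multiplication by every bounded β-periodic function (`map_mulLp_of_map_modChar`). So does S⁻¹, and
S⁻¹f(t) therefore involves f only along t + βℤ, with coefficients ω_k(t) in front of f(t + kβ). The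
remaining question is where ω_k can be nonzero.

The support bounds come from further sets E whose indicators commute with S. The part of S built
from the modulates of T_{na}g sees only the window [c,d] + na. So it suffices that E agrees on each
window with some β-periodic set, which may depend on n (`gabor_map_indLp`). As d - c < 2β, two
distinct points of one coset of βℤ in a window differ by β, and the right one then lies in the link
[c + β, d] + na. Hence the points left of lβ on cosets with no link in [lβ, (l+1)β) form such a set
E (`cutLeft_agrees`). Consequently S⁻¹ transports mass across lβ only along linked cosets, and
transport over k cells needs k consecutive links.

Since a < β and d - c ≤ 2a, the window index moves by exactly one from link to link, up to a null
set. The k conditions thus collapse to a single interval (`exists_mem_Icc_of_chain`). Its length d -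
c - a - k(β - a) is negative for k > K, so the sum is finite. Part (ii) puts f = g and keeps the
intervals compatible with supp g. -/

/-! ### Bessel families and frame operators -/

section Frames

variable {ι H : Type*} [NormedAddCommGroup H] [InnerProductSpace ℂ H]

/-- The family `φ` satisfies the Bessel inequality with bound `B`. -/
def IsBessel (φ : ι → H) (B : ℝ) : Prop :=
  ∀ f : H, Summable (fun i => ‖⟪φ i, f⟫_ℂ‖ ^ 2) ∧ ∑' i, ‖⟪φ i, f⟫_ℂ‖ ^ 2 ≤ B * ‖f‖ ^ 2

theorem IsBessel.comp_injective {κ : Type*} {φ : ι → H} {B : ℝ} (h : IsBessel φ B) {σ : κ → ι}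
    (hσ : Function.Injective σ) : IsBessel (fun j => φ (σ j)) B := fun f =>
  ⟨(h f).1.comp_injective hσ,
    ((h f).1.comp_injective hσ).tsum_le_tsum_of_inj σ hσ (fun _ _ => by positivity)
      (fun _ => le_rfl) (h f).1 |>.trans (h f).2⟩

theorem IsBessel.memℓp {φ : ι → H} {B : ℝ} (h : IsBessel φ B) (f : H) :
    Memℓp (fun i => ⟪φ i, f⟫_ℂ) 2 := by
  refine memℓp_gen ?_
  simpa using (h f).1

/-- The analysis operator `f ↦ (⟨φ i, f⟩)ᵢ` of a Bessel family. -/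
noncomputable def IsBessel.analysis {φ : ι → H} {B : ℝ} (h : IsBessel φ B) :
    H →L[ℂ] lp (fun _ : ι => ℂ) 2 :=
  LinearMap.mkContinuous
    { toFun := fun f => ⟨fun i => ⟪φ i, f⟫_ℂ, h.memℓp f⟩
      map_add' := fun f f' => by ext i; exact inner_add_right _ _ _
      map_smul' := fun c f => by ext i; exact inner_smul_right _ _ _ }
    (Real.sqrt B) (fun f => by
      rcases eq_or_ne f 0 with rfl | hf
      · rw [map_zero]; simp
      have hB : 0 ≤ B := by
        have h1 : 0 ≤ B * ‖f‖ ^ 2 := (tsum_nonneg fun _ => by positivity).trans (h f).2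
        have h2 : 0 < ‖f‖ ^ 2 := by positivity
        exact nonneg_of_mul_nonneg_left h1 h2
      refine (sq_le_sq₀ (norm_nonneg _) (by positivity)).1 ?_
      rw [mul_pow, Real.sq_sqrt hB]
      refine le_trans (le_of_eq ?_) (h f).2
      have := lp.norm_rpow_eq_tsum (p := 2) (by norm_num)
        (⟨fun i => ⟪φ i, f⟫_ℂ, h.memℓp f⟩ : lp (fun _ : ι => ℂ) 2)
      simpa using this)

theorem IsBessel.analysis_apply {φ : ι → H} {B : ℝ} (h : IsBessel φ B) (f : H) (i : ι) :
    h.analysis f i = ⟪φ i, f⟫_ℂ := rfl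

/-- Only the Bessel bound is needed, so this also serves the subfamilies with a fixed translation,
which need not be frames. -/
theorem IsBessel.exists_isFrameOperator [CompleteSpace H] {φ : ι → H} {B : ℝ}
    (h : IsBessel φ B) : ∃ S : H →L[ℂ] H, IsFrameOperator φ S := by
  classical
  refine ⟨(ContinuousLinearMap.adjoint h.analysis).comp h.analysis, fun f => ?_⟩
  have h1 := lp.hasSum_single (p := 2) (by norm_num) (h.analysis f)
  have h2 := (ContinuousLinearMap.adjoint h.analysis).hasSum h1
  refine h2.congr_fun ?_
  intro i
  refine ext_inner_right ℂ fun v => ?_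
  refine Eq.trans ?_ (ContinuousLinearMap.adjoint_inner_left h.analysis _ _).symm
  refine Eq.trans ?_ (lp.inner_single_left i (h.analysis f i) (h.analysis v)).symm
  rw [h.analysis_apply, h.analysis_apply, inner_smul_left, RCLike.inner_apply, mul_comm]

/-- The lower frame bound reads A‖f‖² ≤ |⟨f, Sf⟩|, and this coercivity makes S invertible. -/
theorem IsFrameOperator.exists_equiv [CompleteSpace H] {φ : ι → H} (hφ : IsFrame φ) :
    ∃ S : H ≃L[ℂ] H, IsFrameOperator φ S := by
  obtain ⟨A, B, hA, -, h⟩ := hφ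
  have hB : IsBessel φ B := fun f => ⟨(h f).1, (h f).2.2⟩
  obtain ⟨S, hS⟩ := hB.exists_isFrameOperator
  have hu : IsUnit S := by
    refine S.isUnit_of_forall_le_norm_inner_map (c := ⟨A, hA.le⟩) hA fun f => ?_
    have h1 : HasSum (fun i => ((‖⟪φ i, f⟫_ℂ‖ ^ 2 : ℝ) : ℂ)) ⟪f, S f⟫_ℂ := by
      refine ((innerSL ℂ f).hasSum (hS f)).congr_fun ?_
      intro i
      simp only [innerSL_apply_apply, inner_smul_right]
      rw [← inner_conj_symm f (φ i), RCLike.mul_conj]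
      simp
    have h2 : HasSum (fun i => ((‖⟪φ i, f⟫_ℂ‖ ^ 2 : ℝ) : ℂ))
        ((∑' i, ‖⟪φ i, f⟫_ℂ‖ ^ 2 : ℝ) : ℂ) := Complex.hasSum_ofReal.2 (h f).1.hasSum
    rw [← inner_conj_symm, RCLike.norm_conj, h1.unique h2, Complex.norm_real,
      Real.norm_of_nonneg (tsum_nonneg fun _ => by positivity), mul_comm]
    exact (h f).2.1
  obtain ⟨u, rfl⟩ := hu
  exact ⟨ContinuousLinearEquiv.ofUnit u, hS⟩

theorem IsFrameOperator.map_comm {φ : ι → H} {S : H →L[ℂ] H} (hS : IsFrameOperator φ S)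
    (V : H →L[ℂ] H) (σ : ι ≃ ι) (hV : ∀ i, V (φ i) = φ (σ i))
    (hV' : ∀ f f', ⟪V f, V f'⟫_ℂ = ⟪f, f'⟫_ℂ) (f : H) : S (V f) = V (S f) := by
  have h1 := (σ.hasSum_iff (f := fun i => ⟪φ i, V f⟫_ℂ • φ i)).2 (hS (V f))
  have h2 := V.hasSum (hS f)
  refine h1.unique (h2.congr_fun fun i => ?_)
  rw [Function.comp_apply, map_smul, hV, ← hV i, hV']

/-- S sees a vector only through its coefficients against the family, and its values are series in
the family. Hence V and W are indistinguishable on either side of S, however they differ elsewhere.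
-/
theorem IsFrameOperator.map_comm_of_eqOn {φ : ι → H} {S : H →L[ℂ] H} (hS : IsFrameOperator φ S)
    {V W : H →L[ℂ] H} (hVs : ∀ f f', ⟪V f, f'⟫_ℂ = ⟪f, V f'⟫_ℂ)
    (hWs : ∀ f f', ⟪W f, f'⟫_ℂ = ⟪f, W f'⟫_ℂ) (hVW : ∀ i, V (φ i) = W (φ i))
    (hW : ∀ f, S (W f) = W (S f)) (f : H) : S (V f) = V (S f) := by
  have h1 : S (V f) = S (W f) := by
    refine (hS (V f)).unique ((hS (W f)).congr_fun fun i => ?_)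
    rw [← hVs, ← hWs, hVW]
  have h2 : V (S f) = W (S f) := by
    refine (V.hasSum (hS f)).unique ((W.hasSum (hS f)).congr_fun fun i => ?_)
    simp [hVW]
  rw [h1, h2, hW]

end Frames

/-! ### Characters and integrals against β-periodic functions -/

/-- The character `t ↦ e^{2πiωt}`. -/
noncomputable def modChar (ω t : ℝ) : ℂ :=
  Complex.exp (((2 * Real.pi * ω * t : ℝ) : ℂ) * Complex.I)

theorem continuous_modChar (ω : ℝ) : Continuous (modChar ω) := by
  unfold modChar; fun_prop

theorem norm_modChar (ω t : ℝ) : ‖modChar ω t‖ = 1 := by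
  rw [modChar, Complex.norm_exp_ofReal_mul_I]

theorem modChar_add (ω ω' t : ℝ) : modChar (ω + ω') t = modChar ω t * modChar ω' t := by
  rw [modChar, modChar, modChar, ← Complex.exp_add]
  congr 1; push_cast; ring

theorem conj_modChar_mul (ω t : ℝ) : (starRingEnd ℂ) (modChar ω t) * modChar ω t = 1 := by
  rw [mul_comm, RCLike.mul_conj, norm_modChar]; simp

theorem fourier_eq_modChar (β : ℝ) (m : ℤ) (t : ℝ) :
    fourier m (t : AddCircle β) = modChar (m * β⁻¹) t := by
  rw [fourier_coe_apply, modChar]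
  congr 1; push_cast; field_simp

section Periodic

variable {β : ℝ} [hβ : Fact (0 < β)]

/-- Integrating against the integrable w is continuous in the sup norm, and trigonometric
polynomials are dense in the continuous functions on the circle. -/
theorem integral_continuousMap_mul_eq_zero {w : ℝ → ℂ} (hw : Integrable w)
    (h : ∀ m : ℤ, ∫ t, modChar (m * β⁻¹) t * w t = 0) (q : C(AddCircle β, ℂ)) :
    ∫ t : ℝ, q (t : AddCircle β) * w t = 0 := by
  have hint : ∀ q : C(AddCircle β, ℂ), Integrable fun t : ℝ => q (t : AddCircle β) * w t := by
    intro q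
    refine hw.bdd_mul (c := ‖q‖) ?_ (Filter.Eventually.of_forall fun t => q.norm_coe_le_norm _)
    exact (q.continuous.comp (AddCircle.continuous_mk' β)).aestronglyMeasurable
  let Λ : C(AddCircle β, ℂ) →L[ℂ] ℂ := LinearMap.mkContinuous
    { toFun := fun q => ∫ t : ℝ, q (t : AddCircle β) * w t
      map_add' := fun q q' => by
        rw [← integral_add (hint q) (hint q')]
        simp [add_mul]
      map_smul' := fun c q => by
        simp [mul_assoc, integral_const_mul] }
    (∫ t, ‖w t‖) (fun q => by
      refine (norm_integral_le_integral_norm _).trans ?_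
      rw [mul_comm, ← integral_const_mul]
      refine integral_mono (hint q).norm (hw.norm.const_mul _) fun t => ?_
      simp only [norm_mul]
      gcongr
      exact q.norm_coe_le_norm _)
  have hker : (Submodule.span ℂ (Set.range <| @fourier β)).topologicalClosure ≤ Λ.ker := by
    refine Submodule.topologicalClosure_minimal _ (Submodule.span_le.2 ?_) Λ.isClosed_ker
    rintro _ ⟨m, rfl⟩
    change ∫ t : ℝ, fourier m (t : AddCircle β) * w t = 0
    simpa only [fourier_eq_modChar] using h m
  rw [span_fourier_closure_eq_top] at hker
  exact hker (Submodule.mem_top (x := q))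

/-- Continuous functions are dense in L¹(ν), where ν is the image of |w| dt on the circle; the L¹(ν)
distance dominates the change of the integral. -/
theorem integral_addCircle_mul_eq_zero {w : ℝ → ℂ} (hw : Integrable w)
    (h : ∀ m : ℤ, ∫ t, modChar (m * β⁻¹) t * w t = 0) {q : AddCircle β → ℂ} (hq : Measurable q)
    {C : ℝ} (hC : ∀ x, ‖q x‖ ≤ C) : ∫ t : ℝ, q (t : AddCircle β) * w t = 0 := by
  let μ : Measure ℝ := volume.withDensity fun t => ‖w t‖ₑ
  have hmk : Measurable fun t : ℝ => (t : AddCircle β) := AddCircle.measurable_mk'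
  have : IsFiniteMeasure μ := isFiniteMeasure_withDensity hw.2.ne
  let ν : Measure (AddCircle β) := μ.map fun t : ℝ => (t : AddCircle β)
  have : IsFiniteMeasure ν := by dsimp only [ν]; infer_instance
  have hqi : Integrable q ν :=
    Integrable.of_bound hq.aestronglyMeasurable C (Filter.Eventually.of_forall hC)
  have key : ∀ ε > 0, ‖∫ t : ℝ, q (t : AddCircle β) * w t‖ ≤ ε := by
    intro ε hε
    obtain ⟨p, hp, -⟩ := hqi.exists_boundedContinuous_integral_sub_le hε
    have h0 := integral_continuousMap_mul_eq_zero hw h p.toContinuousMap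
    have i1 : Integrable fun t : ℝ => q (t : AddCircle β) * w t :=
      hw.bdd_mul (c := C) (hq.comp hmk).aestronglyMeasurable (Filter.Eventually.of_forall fun t => hC _)
    have i2 : Integrable fun t : ℝ => p (t : AddCircle β) * w t :=
      hw.bdd_mul (c := ‖p‖) (p.continuous.measurable.comp hmk).aestronglyMeasurable
        (Filter.Eventually.of_forall fun t => p.norm_coe_le_norm _)
    have h1 : ∫ t : ℝ, q (t : AddCircle β) * w t =
        ∫ t : ℝ, (q (t : AddCircle β) - p (t : AddCircle β)) * w t := by
      simp only [sub_mul]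
      rw [integral_sub i1 i2]
      erw [h0]
      simp
    rw [h1]
    refine (norm_integral_le_integral_norm _).trans (le_trans (le_of_eq ?_) hp)
    refine Eq.trans ?_ (integral_map (μ := μ) hmk.aemeasurable
      (f := fun x => ‖q x - p x‖) (hq.sub p.continuous.measurable).norm.aestronglyMeasurable).symm
    have : μ = volume.withDensity fun t => ENNReal.ofNNReal ‖w t‖₊ := rfl
    rw [this, integral_withDensity_eq_integral_smul₀ hw.1.aemeasurable.nnnorm]
    refine integral_congr_ae (Filter.Eventually.of_forall fun t => ?_)
    simp [NNReal.smul_def, mul_comm]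
  exact norm_le_zero_iff.1 (le_of_forall_pos_le_add fun ε hε => by simpa using key ε hε)

theorem integral_periodic_mul_eq_zero {w : ℝ → ℂ} (hw : Integrable w)
    (h : ∀ m : ℤ, ∫ t, modChar (m * β⁻¹) t * w t = 0) {p : ℝ → ℂ} (hp : Measurable p)
    (hper : Function.Periodic p β) {C : ℝ} (hC : ∀ x, ‖p x‖ ≤ C) : ∫ t, p t * w t = 0 := by
  let q : AddCircle β → ℂ := fun x => p (AddCircle.measurableEquivIoc β 0 x)
  have hq : Measurable q :=
    hp.comp (measurable_subtype_coe.comp (AddCircle.measurableEquivIoc β 0).measurable)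
  have h1 : ∀ x : AddCircle β, q x = hper.lift x := by
    intro x
    obtain ⟨y, rfl⟩ := (AddCircle.measurableEquivIoc β 0).symm.surjective x
    simp only [q, MeasurableEquiv.apply_symm_apply]
    exact (hper.lift_coe y).symm
  have h2 : ∀ t : ℝ, q (t : AddCircle β) = p t := fun t => by rw [h1, hper.lift_coe]
  simpa only [h2] using integral_addCircle_mul_eq_zero hw h hq fun x => hC _

end Periodic

/-! ### Multiplication operators on L²(ℝ) -/

/-- Bounded measurable functions. -/
def BddMeas (p : ℝ → ℂ) : Prop := Measurable p ∧ ∃ C : ℝ, ∀ t, ‖p t‖ ≤ C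

theorem BddMeas.memLp_mul {p : ℝ → ℂ} (hp : BddMeas p) {f : ℝ → ℂ} (hf : MemLp f 2 volume) :
    MemLp (fun t => p t * f t) 2 volume := by
  obtain ⟨hm, C, hC⟩ := hp
  refine hf.of_le_mul (c := C) (hm.aestronglyMeasurable.mul hf.1)
    (Filter.Eventually.of_forall fun t => ?_)
  rw [norm_mul]
  gcongr
  exact hC t

/-- Multiplication by a bounded measurable function, as an operator on `L²(ℝ)`. -/
noncomputable def mulLp {p : ℝ → ℂ} (hp : BddMeas p) :
    Lp ℂ 2 (volume : Measure ℝ) →L[ℂ] Lp ℂ 2 (volume : Measure ℝ) :=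
  LinearMap.mkContinuous
    { toFun := fun f => (hp.memLp_mul (Lp.memLp f)).toLp
      map_add' := fun f f' => by
        refine Lp.ext ?_
        filter_upwards [(hp.memLp_mul (Lp.memLp (f + f'))).coeFn_toLp,
          (hp.memLp_mul (Lp.memLp f)).coeFn_toLp, (hp.memLp_mul (Lp.memLp f')).coeFn_toLp,
          Lp.coeFn_add f f', Lp.coeFn_add (hp.memLp_mul (Lp.memLp f)).toLp
            (hp.memLp_mul (Lp.memLp f')).toLp] with t h1 h2 h3 h4 h5
        rw [h1, h5, Pi.add_apply, h2, h3, h4, Pi.add_apply, mul_add]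
      map_smul' := fun c f => by
        refine Lp.ext ?_
        filter_upwards [(hp.memLp_mul (Lp.memLp (c • f))).coeFn_toLp,
          (hp.memLp_mul (Lp.memLp f)).coeFn_toLp, Lp.coeFn_smul c f,
          Lp.coeFn_smul c (hp.memLp_mul (Lp.memLp f)).toLp] with t h1 h2 h3 h4
        rw [h1, RingHom.id_apply, h4, Pi.smul_apply, h2, h3, Pi.smul_apply, smul_eq_mul,
          smul_eq_mul, mul_left_comm] }
    hp.2.choose (fun f => by
      refine Lp.norm_le_mul_norm_of_ae_le_mul ?_
      filter_upwards [(hp.memLp_mul (Lp.memLp f)).coeFn_toLp] with t h1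
      refine (congrArg norm h1).trans_le ?_
      rw [norm_mul]
      gcongr
      exact hp.2.choose_spec t)

theorem coeFn_mulLp {p : ℝ → ℂ} (hp : BddMeas p) (f : Lp ℂ 2 (volume : Measure ℝ)) :
    mulLp hp f =ᵐ[volume] fun t => p t * f t :=
  (hp.memLp_mul (Lp.memLp f)).coeFn_toLp

theorem BddMeas.conj {p : ℝ → ℂ} (hp : BddMeas p) :
    BddMeas fun t => (starRingEnd ℂ) (p t) :=
  ⟨Complex.continuous_conj.measurable.comp hp.1, hp.2.imp fun C hC t => by simpa using hC t⟩

theorem mulLp_inner {p : ℝ → ℂ} (hp : BddMeas p) (f f' : Lp ℂ 2 (volume : Measure ℝ)) :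
    ⟪mulLp hp f, f'⟫_ℂ = ⟪f, mulLp hp.conj f'⟫_ℂ := by
  rw [L2.inner_def, L2.inner_def]
  refine integral_congr_ae ?_
  filter_upwards [coeFn_mulLp hp f, coeFn_mulLp hp.conj f'] with t h1 h2
  rw [h1, h2]
  simp only [RCLike.inner_apply, map_mul]
  ring

theorem bddMeas_modChar (ω : ℝ) : BddMeas (modChar ω) :=
  ⟨(continuous_modChar ω).measurable, 1, fun t => (norm_modChar ω t).le⟩

theorem inner_mulLp_modChar (ω : ℝ) (f f' : Lp ℂ 2 (volume : Measure ℝ)) :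
    ⟪mulLp (bddMeas_modChar ω) f, mulLp (bddMeas_modChar ω) f'⟫_ℂ = ⟪f, f'⟫_ℂ := by
  rw [mulLp_inner]
  congr 1
  refine Lp.ext ?_
  filter_upwards [coeFn_mulLp (bddMeas_modChar ω).conj (mulLp (bddMeas_modChar ω) f'),
    coeFn_mulLp (bddMeas_modChar ω) f'] with t h1 h2
  rw [h1, h2, ← mul_assoc, conj_modChar_mul, one_mul]

theorem bddMeas_indicator {E : Set ℝ} (hE : MeasurableSet E) :
    BddMeas (E.indicator fun _ => (1 : ℂ)) := by
  refine ⟨measurable_const.indicator hE, 1, fun t => ?_⟩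
  by_cases h : t ∈ E <;> simp [h]

/-- Multiplication by the indicator function of `E`. -/
noncomputable def indLp {E : Set ℝ} (hE : MeasurableSet E) :
    Lp ℂ 2 (volume : Measure ℝ) →L[ℂ] Lp ℂ 2 (volume : Measure ℝ) :=
  mulLp (bddMeas_indicator hE)

theorem coeFn_indLp {E : Set ℝ} (hE : MeasurableSet E) (f : Lp ℂ 2 (volume : Measure ℝ)) :
    indLp hE f =ᵐ[volume] E.indicator f := by
  filter_upwards [coeFn_mulLp (bddMeas_indicator hE) f] with t ht
  rw [indLp, ht]
  by_cases h : t ∈ E <;> simp [h]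

theorem indLp_inner {E : Set ℝ} (hE : MeasurableSet E) (f f' : Lp ℂ 2 (volume : Measure ℝ)) :
    ⟪indLp hE f, f'⟫_ℂ = ⟪f, indLp hE f'⟫_ℂ := by
  rw [indLp, mulLp_inner]
  congr 1
  refine Lp.ext ?_
  filter_upwards [coeFn_mulLp (bddMeas_indicator hE).conj f',
    coeFn_mulLp (bddMeas_indicator hE) f'] with t h1 h2
  rw [h1, h2]
  by_cases h : t ∈ E <;> simp [h]

/-- An operator that commutes with the modulations by multiples of `β⁻¹` commutes with
multiplication by every bounded `β`-periodic function. -/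
theorem map_mulLp_of_map_modChar {β : ℝ} [Fact (0 < β)]
    (U : Lp ℂ 2 (volume : Measure ℝ) →L[ℂ] Lp ℂ 2 (volume : Measure ℝ))
    (hU : ∀ (m : ℤ) f, U (mulLp (bddMeas_modChar (m * β⁻¹)) f) =
      mulLp (bddMeas_modChar (m * β⁻¹)) (U f))
    {p : ℝ → ℂ} (hp : BddMeas p) (hper : Function.Periodic p β)
    (f : Lp ℂ 2 (volume : Measure ℝ)) : U (mulLp hp f) = mulLp hp (U f) := by
  refine ext_inner_left ℂ fun v => ?_
  let v' := ContinuousLinearMap.adjoint U v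
  -- `w` does not depend on the multiplier: by `key`, the commutator with multiplication by p,
  -- tested against v, is ∫ p w.
  let w : ℝ → ℂ := fun t => ⟪v' t, f t⟫_ℂ - ⟪v t, U f t⟫_ℂ
  have i1 : ∀ u u' : Lp ℂ 2 (volume : Measure ℝ), Integrable fun t => ⟪u t, u' t⟫_ℂ :=
    fun u u' => L2.integrable_inner u u'
  have hw : Integrable w := (i1 v' f).sub (i1 v (U f))
  have key : ∀ {p : ℝ → ℂ} (hp : BddMeas p),
      ⟪v, U (mulLp hp f)⟫_ℂ - ⟪v, mulLp hp (U f)⟫_ℂ = ∫ t, p t * w t := by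
    intro p hp
    rw [← ContinuousLinearMap.adjoint_inner_left, L2.inner_def, L2.inner_def,
      ← integral_sub (i1 _ _) (i1 _ _)]
    refine integral_congr_ae ?_
    filter_upwards [coeFn_mulLp hp f, coeFn_mulLp hp (U f)] with t h1 h2
    rw [h1, h2]
    simp only [w, v', RCLike.inner_apply]
    ring
  have h0 : ∀ m : ℤ, ∫ t, modChar (m * β⁻¹) t * w t = 0 := fun m => by
    rw [← key (bddMeas_modChar _), hU, sub_self]
  obtain ⟨C, hC⟩ := hp.2
  exact sub_eq_zero.1 ((key hp).trans (integral_periodic_mul_eq_zero hw h0 hp.1 hper hC))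

theorem map_indLp_of_map_modChar {β : ℝ} [Fact (0 < β)]
    (U : Lp ℂ 2 (volume : Measure ℝ) →L[ℂ] Lp ℂ 2 (volume : Measure ℝ))
    (hU : ∀ (m : ℤ) f, U (mulLp (bddMeas_modChar (m * β⁻¹)) f) =
      mulLp (bddMeas_modChar (m * β⁻¹)) (U f))
    {E : Set ℝ} (hE : MeasurableSet E) (hper : ∀ t, t + β ∈ E ↔ t ∈ E)
    (f : Lp ℂ 2 (volume : Measure ℝ)) : U (indLp hE f) = indLp hE (U f) := by
  refine map_mulLp_of_map_modChar (β := β) U hU _ (fun t => ?_) f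
  by_cases h : t ∈ E
  · simp [h, (hper t).2 h]
  · simp [h, mt (hper t).1 h]

/-! ### Commutation properties of the Gabor frame operator -/

theorem coeFn_gaborSystem (g : Lp ℂ 2 (volume : Measure ℝ)) (a b : ℝ) (p : ℤ × ℤ) :
    gaborSystem g a b p =ᵐ[volume] fun t => g (t - p.2 * a) * modChar (p.1 * b) t :=
  (memLp_freqShift (memLp_timeShift (Lp.memLp g) (p.2 * a)) (p.1 * b)).coeFn_toLp

theorem mulLp_modChar_gaborSystem (g : Lp ℂ 2 (volume : Measure ℝ)) (a b : ℝ) (k m n : ℤ) :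
    mulLp (bddMeas_modChar (k * b)) (gaborSystem g a b (m, n)) =
      gaborSystem g a b (m + k, n) := by
  refine Lp.ext ?_
  filter_upwards [coeFn_mulLp (bddMeas_modChar (k * b)) (gaborSystem g a b (m, n)),
    coeFn_gaborSystem g a b (m, n), coeFn_gaborSystem g a b (m + k, n)] with t h1 h2 h3
  rw [h1, h2, h3]
  simp only [Int.cast_add, add_mul, modChar_add]
  ring

theorem ae_gaborSystem_eq_zero {g : Lp ℂ 2 (volume : Measure ℝ)} {c d : ℝ}
    (hg : EssSuppSubset g (Set.Icc c d)) (a b : ℝ) (m n : ℤ) :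
    EssSuppSubset (gaborSystem g a b (m, n)) (Set.Icc (c + n * a) (d + n * a)) := by
  have h := (measurePreserving_sub_right volume ((n : ℝ) * a)).quasiMeasurePreserving.ae hg
  filter_upwards [coeFn_gaborSystem g a b (m, n), h] with t h1 h2 h3
  rw [h1]
  rw [h2, zero_mul]
  simp only [Set.mem_Icc, not_and, not_le] at h3 ⊢
  intro h4
  linarith [h3 (by linarith)]

section Commutation

variable {g : Lp ℂ 2 (volume : Measure ℝ)} {a β c d B : ℝ}
  {S : Lp ℂ 2 (volume : Measure ℝ) →L[ℂ] Lp ℂ 2 (volume : Measure ℝ)}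

theorem gabor_map_modChar (hS : IsFrameOperator (gaborSystem g a β⁻¹) S) (k : ℤ)
    (f : Lp ℂ 2 (volume : Measure ℝ)) :
    S (mulLp (bddMeas_modChar (k * β⁻¹)) f) = mulLp (bddMeas_modChar (k * β⁻¹)) (S f) :=
  hS.map_comm _ ((Equiv.addRight k).prodCongr (Equiv.refl ℤ))
    (fun p => mulLp_modChar_gaborSystem g a β⁻¹ k p.1 p.2) (inner_mulLp_modChar _) f

theorem gabor_fiber_map_modChar {n : ℤ}
    (hS : IsFrameOperator (fun m : ℤ => gaborSystem g a β⁻¹ (m, n)) S) (k : ℤ)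
    (f : Lp ℂ 2 (volume : Measure ℝ)) :
    S (mulLp (bddMeas_modChar (k * β⁻¹)) f) = mulLp (bddMeas_modChar (k * β⁻¹)) (S f) :=
  hS.map_comm _ (Equiv.addRight k)
    (fun m => mulLp_modChar_gaborSystem g a β⁻¹ k m n) (inner_mulLp_modChar _) f

/-- If on each interval `[c, d] + na` the set `E` agrees with a `β`-periodic set, then the frame
operator commutes with the multiplication by the indicator function of `E`. -/
theorem gabor_map_indLp [Fact (0 < β)] (hg : EssSuppSubset g (Set.Icc c d))
    (hB : IsBessel (gaborSystem g a β⁻¹) B) (hS : IsFrameOperator (gaborSystem g a β⁻¹) S)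
    {E : Set ℝ} (hE : MeasurableSet E)
    (hP : ∀ n : ℤ, ∃ P : Set ℝ, MeasurableSet P ∧ (∀ t, t + β ∈ P ↔ t ∈ P) ∧
      ∀ t ∈ Set.Icc (c + n * a) (d + n * a), t ∈ E ↔ t ∈ P)
    (f : Lp ℂ 2 (volume : Measure ℝ)) : S (indLp hE f) = indLp hE (S f) := by
  -- S is the sum over n of the frame operators `Sn n` of the families with n fixed, so each may be
  -- treated with its own periodic set.
  have hBn : ∀ n : ℤ, IsBessel (fun m : ℤ => gaborSystem g a β⁻¹ (m, n)) B := fun n =>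
    hB.comp_injective (Prod.mk_left_injective n)
  choose Sn hSn using fun n => (hBn n).exists_isFrameOperator
  have hsum : ∀ f, HasSum (fun n => Sn n f) (S f) := fun f =>
    HasSum.prod_fiberwise (((Equiv.prodComm ℤ ℤ).hasSum_iff).2 (hS f)) fun n => hSn n f
  have hcomm : ∀ n f, Sn n (indLp hE f) = indLp hE (Sn n f) := by
    intro n f
    obtain ⟨P, hPm, hPper, hPE⟩ := hP n
    refine (hSn n).map_comm_of_eqOn (W := indLp hPm) (indLp_inner hE) (indLp_inner hPm)
      (fun m => ?_) (map_indLp_of_map_modChar _ (gabor_fiber_map_modChar (hSn n)) hPm hPper) f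
    refine Lp.ext ?_
    filter_upwards [coeFn_indLp hE (gaborSystem g a β⁻¹ (m, n)),
      coeFn_indLp hPm (gaborSystem g a β⁻¹ (m, n)),
      ae_gaborSystem_eq_zero hg a β⁻¹ m n] with t h1 h2 h3
    rw [h1, h2]
    by_cases ht : t ∈ Set.Icc (c + n * a) (d + n * a)
    · by_cases h : t ∈ E
      · simp [h, (hPE t ht).1 h]
      · simp [h, mt (hPE t ht).2 h]
    · rw [Set.indicator_apply_eq_zero.2 fun _ => h3 ht, Set.indicator_apply_eq_zero.2 fun _ => h3 ht]
  refine (hsum (indLp hE f)).unique (((indLp hE).hasSum (hsum f)).congr_fun fun n => ?_)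
  exact hcomm n f

end Commutation

/-! ### Cut sets that look periodic on every window -/

/-- The `β`-translate of `t` in `[lβ, (l+1)β)`. -/
noncomputable def moveTo (β : ℝ) (l : ℤ) (t : ℝ) : ℝ := t + (l - ⌊t / β⌋) * β

theorem measurable_moveTo (β : ℝ) (l : ℤ) : Measurable (moveTo β l) := by
  have : Measurable fun t : ℝ => ((⌊t / β⌋ : ℤ) : ℝ) :=
    (measurable_of_countable _).comp (Int.measurable_floor.comp (measurable_id.div_const β))
  exact measurable_id.add ((measurable_const.sub this).mul_const β)

theorem floor_add_mul_div {β : ℝ} (hβ : 0 < β) (t : ℝ) (m : ℤ) :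
    ⌊(t + m * β) / β⌋ = ⌊t / β⌋ + m := by
  rw [add_div, mul_div_cancel_right₀ _ hβ.ne', Int.floor_add_intCast]

theorem moveTo_add_mul {β : ℝ} (hβ : 0 < β) (l : ℤ) (t : ℝ) (m : ℤ) :
    moveTo β l (t + m * β) = moveTo β l t := by
  rw [moveTo, moveTo, floor_add_mul_div hβ]
  push_cast; ring

/-- The union of the intervals `[c + β, d] + na`. -/
def linkSet (a β c d : ℝ) : Set ℝ := ⋃ n : ℤ, Set.Icc (c + β + n * a) (d + n * a)

theorem measurableSet_linkSet (a β c d : ℝ) : MeasurableSet (linkSet a β c d) :=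
  MeasurableSet.iUnion fun _ => measurableSet_Icc

/-- The points left of `lβ` whose translate in `[lβ, (l+1)β)` is not in the link set. -/
def cutLeft (a β c d : ℝ) (l : ℤ) : Set ℝ :=
  {t | ⌊t / β⌋ < l ∧ moveTo β l t ∉ linkSet a β c d}

theorem measurableSet_cutLeft (a β c d : ℝ) (l : ℤ) : MeasurableSet (cutLeft a β c d l) :=
  (measurableSet_lt (Int.measurable_floor.comp (measurable_id.div_const β))
    measurable_const).inter (measurable_moveTo β l (measurableSet_linkSet a β c d)).compl

theorem cutLeft_agrees {a β c d : ℝ} (hβ : 0 < β) (hd : d - c < 2 * β) (l n : ℤ) :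
    ∃ P : Set ℝ, MeasurableSet P ∧ (∀ t, t + β ∈ P ↔ t ∈ P) ∧
      ∀ t ∈ Set.Icc (c + n * a) (d + n * a), t ∈ cutLeft a β c d l ↔ t ∈ P := by
  let J := cutLeft a β c d l ∩ Set.Icc (c + n * a) (d + n * a)
  -- P is the β-periodization of the part of the cut set inside the window.
  refine ⟨⋃ m : ℤ, (fun t => t + m * β) ⁻¹' J, MeasurableSet.iUnion fun m =>
    (measurable_id.add_const _) ((measurableSet_cutLeft a β c d l).inter measurableSet_Icc),
    fun t => ?_, fun t ht => ⟨fun h => Set.mem_iUnion.2 ⟨0, by simpa [J] using ⟨h, ht⟩⟩, ?_⟩⟩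
  · simp only [Set.mem_iUnion, Set.mem_preimage]
    constructor
    · rintro ⟨m, hm⟩
      exact ⟨m + 1, by convert hm using 1; push_cast; ring⟩
    · rintro ⟨m, hm⟩
      exact ⟨m - 1, by convert hm using 1; push_cast; ring⟩
  · intro h
    obtain ⟨m, ⟨hm1, hm2⟩, hm3, hm4⟩ := Set.mem_iUnion.1 h
    simp only at hm1 hm2 hm3 hm4
    rw [floor_add_mul_div hβ] at hm1
    rw [moveTo_add_mul hβ] at hm2
    refine ⟨?_, hm2⟩
    -- Otherwise t lies in [lβ, (l+1)β) and t - β in the same window, which puts t in a link.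
    by_contra hlt
    have hm : m < 0 := by omega
    have hm' : -2 < m := by
      have : (-2 : ℝ) < m := by
        by_contra hle
        nlinarith [ht.1, ht.2]
      exact_mod_cast this
    obtain rfl : m = -1 := by omega
    have hl : ⌊t / β⌋ = l := by omega
    refine hm2 (Set.mem_iUnion.2 ⟨n, ?_⟩)
    rw [moveTo, hl]
    push_cast at hm3
    simp only [sub_self, zero_mul, add_zero]
    exact ⟨by linarith, ht.2⟩

/-! ### Action on single cells -/

theorem Lp.enorm_sq_eq_lintegral (f : Lp ℂ 2 (volume : Measure ℝ)) :
    ‖f‖ₑ ^ 2 = ∫⁻ t, ‖f t‖ₑ ^ 2 := by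
  have := eLpNorm_nnreal_pow_eq_lintegral (f := f) (μ := volume) (p := 2) two_ne_zero
  rw [Lp.enorm_def]
  simpa using this

/-- The interval `[jβ, (j+1)β)`. -/
def cell (β : ℝ) (j : ℤ) : Set ℝ := {t | ⌊t / β⌋ = j}

theorem measurableSet_cell (β : ℝ) (j : ℤ) : MeasurableSet (cell β j) :=
  (Int.measurable_floor.comp (measurable_id.div_const β)) (measurableSet_singleton j)

theorem moveTo_of_mem_cell {β : ℝ} {i : ℤ} {t : ℝ} (ht : t ∈ cell β i) (l : ℤ) :
    moveTo β l t = t + (l - i) * β := by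
  rw [moveTo, show ⌊t / β⌋ = i from ht]

theorem volume_cell_ne_top {β : ℝ} (hβ : 0 < β) (j : ℤ) : volume (cell β j) ≠ ∞ := by
  refine ((measure_mono (t := Set.Icc (j * β) ((j + 1) * β)) fun t ht => ?_).trans_lt
    measure_Icc_lt_top).ne
  obtain ⟨h1, h2⟩ := Int.floor_eq_iff.1 (show ⌊t / β⌋ = j from ht)
  exact ⟨(le_div_iff₀ hβ).1 h1, ((div_lt_iff₀ hβ).1 h2).le⟩

section

variable {β : ℝ} [hβ : Fact (0 < β)]

/-- The indicator function of `[jβ, (j+1)β)`. -/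
noncomputable def cellLp (β : ℝ) [hβ : Fact (0 < β)] (j : ℤ) : Lp ℂ 2 (volume : Measure ℝ) :=
  indicatorConstLp 2 (measurableSet_cell β j) (volume_cell_ne_top hβ.out j) 1

theorem coeFn_cellLp (j : ℤ) :
    cellLp β j =ᵐ[volume] (cell β j).indicator fun _ => (1 : ℂ) :=
  indicatorConstLp_coeFn

variable {T : Lp ℂ 2 (volume : Measure ℝ) →L[ℂ] Lp ℂ 2 (volume : Measure ℝ)}

/-- On its cell, f is the β-periodic function f ∘ `moveTo β j` times the indicator of the cell. That
multiplier may be unbounded, so it is truncated to the periodic sets `A N`, which exhaust ℝ. -/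
theorem map_indLp_cell (hT : ∀ (m : ℤ) f, T (mulLp (bddMeas_modChar (m * β⁻¹)) f) =
      mulLp (bddMeas_modChar (m * β⁻¹)) (T f)) (j : ℤ) (f : Lp ℂ 2 (volume : Measure ℝ)) :
    T (indLp (measurableSet_cell β j) f) =ᵐ[volume]
      fun t => f (moveTo β j t) * T (cellLp β j) t := by
  have hfm : Measurable fun t => f (moveTo β j t) :=
    (Lp.stronglyMeasurable f).measurable.comp (measurable_moveTo β j)
  have hmove : ∀ t, moveTo β j (t + β) = moveTo β j t := fun t => by
    simpa using moveTo_add_mul hβ.out j t 1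
  let A : ℕ → Set ℝ := fun N => {t | ‖f (moveTo β j t)‖ ≤ N}
  have hA : ∀ N, MeasurableSet (A N) := fun N => measurableSet_le hfm.norm measurable_const
  have hAper : ∀ N t, t + β ∈ A N ↔ t ∈ A N := fun N t => by simp [A, hmove]
  let p : ℕ → ℝ → ℂ := fun N => (A N).indicator fun t => f (moveTo β j t)
  have hp : ∀ N, BddMeas (p N) := fun N => ⟨hfm.indicator (hA N), N, fun t => by
    by_cases h : t ∈ A N
    · rw [show p N t = f (moveTo β j t) from Set.indicator_of_mem h _]
      exact h
    · simp [p, h]⟩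
  have hpper : ∀ N, Function.Periodic (p N) β := fun N t => by
    by_cases h : t ∈ A N
    · simp [p, h, (hAper N t).2 h, hmove]
    · simp [p, h, mt (hAper N t).1 h]
  have heq : ∀ N, indLp (hA N) (indLp (measurableSet_cell β j) f) =
      mulLp (hp N) (cellLp β j) := fun N => by
    refine Lp.ext ?_
    filter_upwards [coeFn_indLp (hA N) (indLp (measurableSet_cell β j) f),
      coeFn_indLp (measurableSet_cell β j) f, coeFn_mulLp (hp N) (cellLp β j),
      coeFn_cellLp (β := β) j] with t h1 h2 h3 h4
    rw [h1, h3, h4]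
    by_cases ht : t ∈ cell β j
    · have : moveTo β j t = t := by rw [moveTo_of_mem_cell ht]; ring
      by_cases hN : t ∈ A N <;> simp [p, hN, h2, ht, this]
    · by_cases hN : t ∈ A N <;> simp [hN, h2, ht]
  have key : ∀ N, ∀ᵐ t, t ∈ A N → T (indLp (measurableSet_cell β j) f) t =
      f (moveTo β j t) * T (cellLp β j) t := fun N => by
    have h := congrArg T (heq N)
    rw [map_indLp_of_map_modChar T hT (hA N) (hAper N),
      map_mulLp_of_map_modChar T hT (hp N) (hpper N)] at h
    filter_upwards [coeFn_indLp (hA N) (T (indLp (measurableSet_cell β j) f)),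
      coeFn_mulLp (hp N) (T (cellLp β j))] with t h1 h2 ht
    rw [h, h2] at h1
    simpa [p, ht] using h1.symm
  filter_upwards [ae_all_iff.2 key] with t ht
  obtain ⟨N, hN⟩ := exists_nat_ge ‖f (moveTo β j t)‖
  exact ht N hN

/-- Any measurable s inside cell i is the trace of a β-periodic set A. Commuting T with the
indicator of A bounds the integral of |T 1_cell|² over s by ‖T‖² |s|; as s is arbitrary, the
pointwise bound follows. -/
theorem norm_map_cellLp_le (hT : ∀ (m : ℤ) f, T (mulLp (bddMeas_modChar (m * β⁻¹)) f) =
      mulLp (bddMeas_modChar (m * β⁻¹)) (T f)) (j : ℤ) :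
    ∀ᵐ t, ‖T (cellLp β j) t‖ ≤ ‖T‖ := by
  have hm : Measurable fun t => ‖T (cellLp β j) t‖ₑ ^ 2 :=
    (Lp.stronglyMeasurable _).measurable.enorm.pow_const 2
  have key : ∀ i : ℤ, ∀ᵐ t, t ∈ cell β i → ‖T (cellLp β j) t‖ₑ ^ 2 ≤ ‖T‖ₑ ^ 2 := by
    intro i
    rw [← ae_restrict_iff' (measurableSet_cell β i)]
    refine ae_le_of_forall_setLIntegral_le_of_sigmaFinite hm fun s hs _ => ?_
    let A : Set ℝ := moveTo β i ⁻¹' s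
    have hA : MeasurableSet A := measurable_moveTo β i hs
    have hAper : ∀ t, t + β ∈ A ↔ t ∈ A := fun t => by
      have := moveTo_add_mul hβ.out i t 1
      simp only [Int.cast_one, one_mul] at this
      simp [A, this]
    rw [Measure.restrict_restrict hs]
    have h1 : ∫⁻ t in s ∩ cell β i, ‖T (cellLp β j) t‖ₑ ^ 2 ≤
        ‖indLp hA (T (cellLp β j))‖ₑ ^ 2 := by
      rw [Lp.enorm_sq_eq_lintegral, ← lintegral_indicator (hs.inter (measurableSet_cell β i))]
      refine lintegral_mono_ae ?_
      filter_upwards [coeFn_indLp hA (T (cellLp β j))] with t ht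
      rw [ht]
      by_cases h : t ∈ s ∩ cell β i
      · have hmem : t ∈ A := by
          have : moveTo β i t = t := by rw [moveTo_of_mem_cell h.2]; ring
          simpa [A, this] using h.1
        simp [h, hmem]
      · simp [h]
    have h2 : ‖indLp hA (cellLp β j)‖ₑ ^ 2 ≤ volume (s ∩ cell β i) := by
      -- A meets cell j in a translate of its trace on cell i.
      have hpre : volume (s ∩ cell β i) =
          volume ((fun t => t + ((i - j : ℤ) : ℝ) * β) ⁻¹' (s ∩ cell β i)) :=
        (measure_preimage_add_right volume _ _).symm
      have hm' : MeasurableSet ((fun t => t + ((i - j : ℤ) : ℝ) * β) ⁻¹' (s ∩ cell β i)) :=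
        (measurable_id.add_const _) (hs.inter (measurableSet_cell β i))
      rw [Lp.enorm_sq_eq_lintegral, hpre, ← lintegral_indicator_one hm']
      refine lintegral_mono_ae ?_
      filter_upwards [coeFn_indLp hA (cellLp β j), coeFn_cellLp (β := β) j] with t h1 h2
      rw [h1]
      by_cases h : t ∈ A ∩ cell β j
      · have hmem : t ∈ (fun t => t + ((i - j : ℤ) : ℝ) * β) ⁻¹' (s ∩ cell β i) := by
          have h3 := h.1
          have h4 : ⌊t / β⌋ = j := h.2
          simp only [A, Set.mem_preimage, moveTo_of_mem_cell h.2] at h3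
          refine ⟨by push_cast; exact h3, ?_⟩
          change ⌊(t + ((i - j : ℤ) : ℝ) * β) / β⌋ = i
          rw [floor_add_mul_div hβ.out, h4]; ring
        rw [Set.indicator_of_mem hmem, Set.indicator_of_mem h.1, h2, Set.indicator_of_mem h.2]
        simp
      · have : A.indicator (cellLp β j) t = 0 := by
          by_cases hA' : t ∈ A
          · rw [Set.indicator_of_mem hA', h2, Set.indicator_of_notMem fun h' => h ⟨hA', h'⟩]
          · rw [Set.indicator_of_notMem hA']
        simp [this]
    rw [setLIntegral_const]
    refine h1.trans ?_
    rw [← map_indLp_of_map_modChar T hT hA hAper]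
    calc ‖T (indLp hA (cellLp β j))‖ₑ ^ 2 ≤ (‖T‖ₑ * ‖indLp hA (cellLp β j)‖ₑ) ^ 2 := by
          gcongr; exact T.le_opENorm _
      _ = ‖T‖ₑ ^ 2 * ‖indLp hA (cellLp β j)‖ₑ ^ 2 := mul_pow _ _ _
      _ ≤ _ := by gcongr
  filter_upwards [ae_all_iff.2 key] with t ht
  have := ht ⌊t / β⌋ rfl
  rw [ENNReal.pow_le_pow_left_iff two_ne_zero] at this
  simpa [enorm_le_iff_norm_le] using this

end

/-! ### Chains of links -/

section Intervals

variable {a β c d t : ℝ}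

/-- Consecutive links have window indices n - 1 and n: equal or reversed indices would need 2β ≤ d -
c, and a gap of two or more leaves at most a lattice point. The last link then supplies the left
bound, the first one the right bound. -/
theorem exists_mem_Icc_of_chain (ha : 0 < a) (haβ : a < β) (hd : d - c ≤ 2 * a) {k : ℕ}
    (hk : 1 ≤ k) : ∀ {t : ℝ}, (∀ i n : ℤ, t ≠ c + i * β + n * a) →
    (∀ i : ℕ, i < k → t - i * β ∈ linkSet a β c d) →
    ∃ n : ℤ, t ∈ Set.Icc (c - ((k : ℝ) - 1) * a + k * β + n * a) (d + n * a) := by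
  induction k, hk using Nat.le_induction with
  | base =>
    intro t _ h
    obtain ⟨n, h1, h2⟩ := Set.mem_iUnion.1 (h 0 one_pos)
    simp only [Nat.cast_zero, zero_mul, sub_zero] at h1 h2
    exact ⟨n, by simpa using h1, h2⟩
  | succ k hk ih =>
    intro t hN h
    obtain ⟨n, h1, h2⟩ := Set.mem_iUnion.1 (h 0 (Nat.succ_pos k))
    simp only [Nat.cast_zero, zero_mul, sub_zero] at h1 h2
    obtain ⟨n', h3, h4⟩ := ih (t := t - β)
      (fun i n h' => hN (i + 1) n (by push_cast; linarith))
      (fun i hi => by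
        have := h (i + 1) (by omega)
        push_cast at this
        convert this using 1; ring)
    have hk1 : (1 : ℝ) ≤ k := by exact_mod_cast hk
    have h5 : c + β ≤ c - ((k : ℝ) - 1) * a + k * β := by
      nlinarith [mul_nonneg (sub_nonneg.2 hk1) (sub_nonneg.2 haβ.le)]
    have hlow : (0 : ℝ) < (n - n' : ℤ) := by
      push_cast
      by_contra hle
      nlinarith
    have hlow' : 0 < n - n' := by exact_mod_cast hlow
    have hup : n - n' ≤ 1 := by
      by_contra hgt
      have h6 : (2 : ℝ) ≤ (n - n' : ℤ) := by
        have : 2 ≤ n - n' := by omega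
        exact_mod_cast this
      push_cast at h6
      refine hN 1 n ?_
      push_cast
      nlinarith
    obtain rfl : n' = n - 1 := by omega
    refine ⟨n, ?_, h2⟩
    push_cast at h3 ⊢
    linarith

/-- The condition on t - kβ leaves only n = k and n = k - 1. The second interval lies in the one
with j = k - 1, or in [c,d] when k = 1, because a < β. -/
theorem mem_of_mem_plus (ha : 0 < a) (haβ : a < β) (hd : d - c ≤ 2 * a)
    (hN : ∀ i n : ℤ, t ≠ c + i * β + n * a) {k : ℕ} (hk : 1 ≤ k) {n : ℤ}
    (ht : t ∈ Set.Icc (c - ((k : ℝ) - 1) * a + k * β + n * a) (d + n * a))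
    (htk : t - k * β ∈ Set.Icc c d) :
    t ∈ Set.Icc c d ∨ ∃ j : ℕ, 1 ≤ j ∧ j ≤ k ∧
      t ∈ Set.Icc (c - ((j : ℝ) - 1) * a + j * β + j * a) (d + j * a) := by
  obtain ⟨h1, h2⟩ := ht
  obtain ⟨h3, h4⟩ := htk
  have hk1 : (1 : ℝ) ≤ k := by exact_mod_cast hk
  have hlow : (k : ℤ) - 2 < n := by
    have : (k : ℝ) - 2 < n := by
      by_contra hle
      nlinarith
    exact_mod_cast this
  have hup : n ≤ k := by
    by_contra hgt
    have h5 : (k : ℝ) + 1 ≤ n := by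
      have : (k : ℤ) + 1 ≤ n := by omega
      exact_mod_cast this
    refine hN k 2 ?_
    push_cast
    nlinarith
  rcases (show n = k ∨ n = k - 1 by omega) with rfl | rfl
  · exact Or.inr ⟨k, hk, le_rfl, by exact_mod_cast h1, by exact_mod_cast h2⟩
  · push_cast at h1 h2
    rcases hk.eq_or_lt with rfl | hk2
    · left
      push_cast at *
      constructor <;> linarith
    · right
      refine ⟨k - 1, by omega, by omega, ?_⟩
      push_cast [hk]
      constructor <;> linarith

theorem mem_of_mem_minus (ha : 0 < a) (haβ : a < β) (hd : d - c ≤ 2 * a)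
    (hN : ∀ i n : ℤ, t ≠ c + i * β + n * a) {k : ℕ} (hk : 1 ≤ k) {n : ℤ}
    (ht : t ∈ Set.Icc (c + n * a) (d + ((k : ℝ) - 1) * a - k * β + n * a))
    (htk : t + k * β ∈ Set.Icc c d) :
    t ∈ Set.Icc c d ∨ ∃ j : ℕ, 1 ≤ j ∧ j ≤ k ∧
      t ∈ Set.Icc (c - j * a) (d + ((j : ℝ) - 1) * a - j * β - j * a) := by
  obtain ⟨h1, h2⟩ := ht
  obtain ⟨h3, h4⟩ := htk
  have hk1 : (1 : ℝ) ≤ k := by exact_mod_cast hk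
  have hup : n < 2 - (k : ℤ) := by
    have : (n : ℝ) < 2 - k := by
      by_contra hle
      nlinarith
    exact_mod_cast this
  have hlow : -(k : ℤ) ≤ n := by
    by_contra hgt
    have h5 : (n : ℝ) + 1 ≤ -k := by
      have : n + 1 ≤ -(k : ℤ) := by omega
      exact_mod_cast this
    refine hN (-k) 0 ?_
    push_cast
    nlinarith
  rcases (show n = -k ∨ n = 1 - k by omega) with rfl | rfl
  · push_cast at h1 h2
    exact Or.inr ⟨k, hk, le_rfl, by linarith, by linarith⟩
  · push_cast at h1 h2
    rcases hk.eq_or_lt with rfl | hk2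
    · left
      push_cast at *
      constructor <;> linarith
    · right
      refine ⟨k - 1, by omega, by omega, ?_⟩
      push_cast [hk]
      constructor <;> linarith

theorem ae_ne_lattice (a β c : ℝ) : ∀ᵐ t : ℝ, ∀ i n : ℤ, t ≠ c + i * β + n * a := by
  simp only [ae_all_iff]
  intro i n
  exact Measure.ae_ne volume _

end Intervals

/-! ### Transport across cell boundaries -/

section Decoupling

variable {a β c d : ℝ} [hβ : Fact (0 < β)]
  {T : Lp ℂ 2 (volume : Measure ℝ) →L[ℂ] Lp ℂ 2 (volume : Measure ℝ)}

omit hβ in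
theorem ae_map_eq_zero_of_left
    (hE : ∀ l f, T (indLp (measurableSet_cutLeft a β c d l) f) =
      indLp (measurableSet_cutLeft a β c d l) (T f))
    {l : ℤ} {f : Lp ℂ 2 (volume : Measure ℝ)} (hf : ∀ᵐ t, ⌊t / β⌋ < l → f t = 0) :
    ∀ᵐ t, ⌊t / β⌋ < l → moveTo β l t ∉ linkSet a β c d → T f t = 0 := by
  have h0 : indLp (measurableSet_cutLeft a β c d l) f = 0 := by
    refine Lp.ext ?_
    filter_upwards [coeFn_indLp (measurableSet_cutLeft a β c d l) f, hf,
      Lp.coeFn_zero ℂ 2 (volume : Measure ℝ)] with t h1 h2 h3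
    rw [h1, h3]
    exact Set.indicator_apply_eq_zero.2 fun h => h2 h.1
  have h1 := hE l f
  rw [h0, map_zero] at h1
  filter_upwards [coeFn_indLp (measurableSet_cutLeft a β c d l) (T f),
    Lp.coeFn_zero ℂ 2 (volume : Measure ℝ)] with t h2 h3 h4 h5
  rw [← h1, h3, Set.indicator_of_mem (show t ∈ cutLeft a β c d l from ⟨h4, h5⟩)] at h2
  exact h2.symm

/-- For f living left of lβ, the cut set and the β-periodic set F of all points on unlinked cosets
restrict f equally. T commutes with both restrictions, and right of lβ the cut set is empty. -/
theorem ae_map_eq_zero_of_right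
    (hT : ∀ (m : ℤ) f, T (mulLp (bddMeas_modChar (m * β⁻¹)) f) =
      mulLp (bddMeas_modChar (m * β⁻¹)) (T f))
    (hE : ∀ l f, T (indLp (measurableSet_cutLeft a β c d l) f) =
      indLp (measurableSet_cutLeft a β c d l) (T f))
    {l : ℤ} {f : Lp ℂ 2 (volume : Measure ℝ)} (hf : ∀ᵐ t, l ≤ ⌊t / β⌋ → f t = 0) :
    ∀ᵐ t, l ≤ ⌊t / β⌋ → moveTo β l t ∉ linkSet a β c d → T f t = 0 := by
  let F : Set ℝ := moveTo β l ⁻¹' (linkSet a β c d)ᶜ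
  have hF : MeasurableSet F := measurable_moveTo β l (measurableSet_linkSet a β c d).compl
  have hFper : ∀ t, t + β ∈ F ↔ t ∈ F := fun t => by
    have := moveTo_add_mul hβ.out l t 1
    simp only [Int.cast_one, one_mul] at this
    simp [F, this]
  have h0 : indLp (measurableSet_cutLeft a β c d l) f = indLp hF f := by
    refine Lp.ext ?_
    filter_upwards [coeFn_indLp (measurableSet_cutLeft a β c d l) f, coeFn_indLp hF f, hf]
      with t h1 h2 h3
    rw [h1, h2]
    by_cases ht : l ≤ ⌊t / β⌋
    · rw [Set.indicator_apply_eq_zero.2 fun _ => h3 ht,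
        Set.indicator_apply_eq_zero.2 fun _ => h3 ht]
    · by_cases h : t ∈ F
      · rw [Set.indicator_of_mem h,
          Set.indicator_of_mem (show t ∈ cutLeft a β c d l from ⟨not_le.1 ht, h⟩)]
      · rw [Set.indicator_of_notMem h, Set.indicator_of_notMem fun h' => h h'.2]
  have h1 := congrArg T h0
  rw [hE, map_indLp_of_map_modChar T hT hF hFper] at h1
  filter_upwards [coeFn_indLp (measurableSet_cutLeft a β c d l) (T f), coeFn_indLp hF (T f)]
    with t h2 h3 h4 h5
  rw [h1, h3, Set.indicator_of_mem (show t ∈ F from h5),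
    Set.indicator_of_notMem fun h => absurd h.1 (not_lt.2 h4)] at h2
  exact h2

omit hβ in
-- A nonzero value at t must pass the cuts l = i+1, …, i+k, so t + β, …, t + kβ all lie in links: a
-- chain ending at t + kβ.
theorem ae_map_eq_zero_of_notMem_minus (ha : 0 < a) (haβ : a < β) (hd : d - c ≤ 2 * a)
    (hE : ∀ l f, T (indLp (measurableSet_cutLeft a β c d l) f) =
      indLp (measurableSet_cutLeft a β c d l) (T f))
    {k : ℕ} (hk : 1 ≤ k) {i : ℤ} {f : Lp ℂ 2 (volume : Measure ℝ)}
    (hf : ∀ᵐ t, ⌊t / β⌋ < i + k → f t = 0) :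
    ∀ᵐ t, t ∈ cell β i →
      (∀ n : ℤ, t ∉ Set.Icc (c + n * a) (d + ((k : ℝ) - 1) * a - k * β + n * a)) →
      T f t = 0 := by
  have h1 : ∀ l : ℤ, ∀ᵐ t, l ≤ i + k → ⌊t / β⌋ < l → moveTo β l t ∉ linkSet a β c d →
      T f t = 0 := fun l => by
    by_cases hl : l ≤ i + k
    · filter_upwards [ae_map_eq_zero_of_left hE (l := l) (f := f)
        (by filter_upwards [hf] with t ht h using ht (h.trans_le hl))] with t ht _ using ht
    · exact Filter.Eventually.of_forall fun t h => absurd h hl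
  filter_upwards [ae_all_iff.2 h1, ae_ne_lattice a β c] with t h2 hN hti hn
  by_contra hne
  obtain ⟨n, h3, h4⟩ := exists_mem_Icc_of_chain ha haβ hd hk (t := t + k * β)
    (fun j n h => hN (j - k) n (by push_cast; linarith)) (fun j hj => by
      by_contra hmem
      refine hne (h2 (i + k - j) (by omega) ?_ ?_)
      · rw [show ⌊t / β⌋ = i from hti]; omega
      · rw [moveTo_of_mem_cell hti]
        convert hmem using 2
        push_cast; ring)
  -- Shifting the plus interval with index n by -kβ gives the minus interval with index n - k + 1.
  refine hn (n - k + 1) ⟨?_, ?_⟩ <;> push_cast <;> linarith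

theorem ae_map_eq_zero_of_notMem_plus (ha : 0 < a) (haβ : a < β) (hd : d - c ≤ 2 * a)
    (hT : ∀ (m : ℤ) f, T (mulLp (bddMeas_modChar (m * β⁻¹)) f) =
      mulLp (bddMeas_modChar (m * β⁻¹)) (T f))
    (hE : ∀ l f, T (indLp (measurableSet_cutLeft a β c d l) f) =
      indLp (measurableSet_cutLeft a β c d l) (T f))
    {k : ℕ} (hk : 1 ≤ k) {i : ℤ} {f : Lp ℂ 2 (volume : Measure ℝ)}
    (hf : ∀ᵐ t, i - k < ⌊t / β⌋ → f t = 0) :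
    ∀ᵐ t, t ∈ cell β i →
      (∀ n : ℤ, t ∉ Set.Icc (c - ((k : ℝ) - 1) * a + k * β + n * a) (d + n * a)) →
      T f t = 0 := by
  have h1 : ∀ l : ℤ, ∀ᵐ t, i - k < l → l ≤ ⌊t / β⌋ → moveTo β l t ∉ linkSet a β c d →
      T f t = 0 := fun l => by
    by_cases hl : i - k < l
    · filter_upwards [ae_map_eq_zero_of_right hT hE (l := l) (f := f)
        (by filter_upwards [hf] with t ht h using ht (hl.trans_le h))] with t ht _ using ht
    · exact Filter.Eventually.of_forall fun t h => absurd h hl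
  filter_upwards [ae_all_iff.2 h1, ae_ne_lattice a β c] with t h2 hN hti hn
  by_contra hne
  obtain ⟨n, hn'⟩ := exists_mem_Icc_of_chain ha haβ hd hk hN (fun j hj => by
      by_contra hmem
      refine hne (h2 (i - j) (by omega) ?_ ?_)
      · rw [show ⌊t / β⌋ = i from hti]; omega
      · rw [moveTo_of_mem_cell hti]
        convert hmem using 2
        push_cast; ring)
  exact hn n hn'

end Decoupling

/-! ### Finite Walnut-type representation -/

theorem Lp.coeFn_finsetSum {ι : Type*} (s : Finset ι) (F : ι → Lp ℂ 2 (volume : Measure ℝ)) :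
    (∑ i ∈ s, F i : Lp ℂ 2 (volume : Measure ℝ)) =ᵐ[volume] fun t => ∑ i ∈ s, F i t := by
  classical
  induction s using Finset.induction_on with
  | empty =>
    filter_upwards with t
    simp
  | insert i s hi ih =>
    rw [Finset.sum_insert hi]
    filter_upwards [ih, Lp.coeFn_add (F i) (∑ i ∈ s, F i)] with t h1 h2
    rw [h2, Pi.add_apply, h1, Finset.sum_insert hi]

theorem measurable_floor_div_apply {β : ℝ} {G : ℤ → ℝ → ℂ} (hG : ∀ i, Measurable (G i)) :
    Measurable fun t : ℝ => G ⌊t / β⌋ t := by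
  have hF : Measurable fun p : ℤ × ℝ => G p.1 p.2 := measurable_from_prod_countable_right hG
  exact hF.comp ((Int.measurable_floor.comp (measurable_id.div_const β)).prodMk measurable_id)

section Walnut

variable {a β c d : ℝ} [hβ : Fact (0 < β)]
  {T : Lp ℂ 2 (volume : Measure ℝ) →L[ℂ] Lp ℂ 2 (volume : Measure ℝ)}

/-- The coefficient functions of an operator that commutes with the modulations by multiples
of `β⁻¹`. -/
noncomputable def walnutCoeff (β : ℝ) [hβ : Fact (0 < β)]
    (T : Lp ℂ 2 (volume : Measure ℝ) →L[ℂ] Lp ℂ 2 (volume : Measure ℝ)) (k : ℤ) (t : ℝ) : ℂ :=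
  T (cellLp β (⌊t / β⌋ + k)) t

theorem memLp_walnutCoeff (hT : ∀ (m : ℤ) f, T (mulLp (bddMeas_modChar (m * β⁻¹)) f) =
      mulLp (bddMeas_modChar (m * β⁻¹)) (T f)) (k : ℤ) :
    MemLp (walnutCoeff β T k) ∞ (volume : Measure ℝ) := by
  have hm : Measurable (walnutCoeff β T k) :=
    measurable_floor_div_apply fun i => (Lp.stronglyMeasurable (T (cellLp β (i + k)))).measurable
  refine memLp_top_of_bound hm.aestronglyMeasurable ‖T‖ ?_
  filter_upwards [ae_all_iff.2 (norm_map_cellLp_le hT)] with t ht using ht _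

omit hβ in
theorem ae_of_forall_cell {P : ℝ → Prop} (h : ∀ i : ℤ, ∀ᵐ t, t ∈ cell β i → P t) :
    ∀ᵐ t, P t := by
  filter_upwards [ae_all_iff.2 h] with t ht using ht _ rfl

theorem walnutCoeff_of_mem_cell {i : ℤ} {t : ℝ} (ht : t ∈ cell β i) (k : ℤ) :
    walnutCoeff β T k t = T (cellLp β (i + k)) t := by
  rw [walnutCoeff, show ⌊t / β⌋ = i from ht]

theorem essSupp_walnutCoeff (ha : 0 < a) (haβ : a < β) (hd : d - c ≤ 2 * a)
    (hE : ∀ l f, T (indLp (measurableSet_cutLeft a β c d l) f) =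
      indLp (measurableSet_cutLeft a β c d l) (T f)) {k : ℕ} (hk : 1 ≤ k) :
    ∀ᵐ t, (∀ n : ℤ, t ∉ Set.Icc (c + n * a) (d + ((k : ℝ) - 1) * a - k * β + n * a)) →
      walnutCoeff β T k t = 0 := by
  refine ae_of_forall_cell (β := β) fun i => ?_
  filter_upwards [ae_map_eq_zero_of_notMem_minus ha haβ hd hE hk (i := i)
    (f := cellLp β (i + k)) (by
      filter_upwards [coeFn_cellLp (β := β) (i + k)] with t ht hlt
      rw [ht, Set.indicator_of_notMem]
      exact fun h => hlt.ne h)] with t ht hti hn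
  rw [walnutCoeff_of_mem_cell hti]
  exact ht hti hn

theorem essSupp_walnutCoeff_neg (ha : 0 < a) (haβ : a < β) (hd : d - c ≤ 2 * a)
    (hT : ∀ (m : ℤ) f, T (mulLp (bddMeas_modChar (m * β⁻¹)) f) =
      mulLp (bddMeas_modChar (m * β⁻¹)) (T f))
    (hE : ∀ l f, T (indLp (measurableSet_cutLeft a β c d l) f) =
      indLp (measurableSet_cutLeft a β c d l) (T f)) {k : ℕ} (hk : 1 ≤ k) :
    ∀ᵐ t, (∀ n : ℤ, t ∉ Set.Icc (c - ((k : ℝ) - 1) * a + k * β + n * a) (d + n * a)) →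
      walnutCoeff β T (-k) t = 0 := by
  refine ae_of_forall_cell (β := β) fun i => ?_
  filter_upwards [ae_map_eq_zero_of_notMem_plus ha haβ hd hT hE hk (i := i)
    (f := cellLp β (i + -k)) (by
      filter_upwards [coeFn_cellLp (β := β) (i + -k)] with t ht hlt
      rw [ht, Set.indicator_of_notMem]
      exact fun h => hlt.ne' h)] with t ht hti hn
  rw [walnutCoeff_of_mem_cell hti]
  exact ht hti hn

/-- The finite Walnut-type representation: only shifts by at most `Kβ` occur when
`(K + 1)(β - a) > d - c - a`. -/
theorem eq_sum_walnutCoeff (ha : 0 < a) (haβ : a < β) (hd : d - c ≤ 2 * a)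
    (hT : ∀ (m : ℤ) f, T (mulLp (bddMeas_modChar (m * β⁻¹)) f) =
      mulLp (bddMeas_modChar (m * β⁻¹)) (T f))
    (hE : ∀ l f, T (indLp (measurableSet_cutLeft a β c d l) f) =
      indLp (measurableSet_cutLeft a β c d l) (T f)) {K : ℕ}
    (hK : d - c - a < (K + 1) * (β - a)) (f : Lp ℂ 2 (volume : Measure ℝ)) :
    T f =ᵐ[volume] fun t =>
      ∑ k ∈ Finset.Icc (-(K : ℤ)) K, walnutCoeff β T k t * f (t + k * β) := by
  refine ae_of_forall_cell (β := β) fun i => ?_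
  have hfl : Measurable fun t : ℝ => ⌊t / β⌋ :=
    Int.measurable_floor.comp (measurable_id.div_const β)
  have hL : MeasurableSet {t : ℝ | ⌊t / β⌋ < i - K} := measurableSet_lt hfl measurable_const
  have hR : MeasurableSet {t : ℝ | i + K < ⌊t / β⌋} := measurableSet_lt measurable_const hfl
  -- Seen from cell i, f splits into the 2K + 1 nearest cells and two tails at distance at least K +
  -- 1 cells.
  have hdec : f = ∑ k ∈ Finset.Icc (-(K : ℤ)) K, indLp (measurableSet_cell β (i + k)) f +
      (indLp hL f + indLp hR f) := by
    refine Lp.ext ?_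
    filter_upwards [Lp.coeFn_add (∑ k ∈ Finset.Icc (-(K : ℤ)) K,
        indLp (measurableSet_cell β (i + k)) f) (indLp hL f + indLp hR f),
      Lp.coeFn_add (indLp hL f) (indLp hR f),
      Lp.coeFn_finsetSum (Finset.Icc (-(K : ℤ)) K)
        fun k => indLp (measurableSet_cell β (i + k)) f,
      ae_all_iff.2 fun k : ℤ => coeFn_indLp (measurableSet_cell β (i + k)) f,
      coeFn_indLp hL f, coeFn_indLp hR f] with t h1 h2 h3 h4 h5 h6
    rw [h1, Pi.add_apply, h2, Pi.add_apply, h3, h5, h6]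
    have hc : ∀ k, indLp (measurableSet_cell β (i + k)) f t =
        if ⌊t / β⌋ = i + k then f t else 0 := fun k => by
      rw [h4]
      split_ifs with h
      · exact Set.indicator_of_mem (s := cell β (i + k)) h f
      · exact Set.indicator_of_notMem (s := cell β (i + k)) h f
    simp only [hc, Set.indicator_apply, Set.mem_ofPred_eq]
    by_cases hl : ⌊t / β⌋ < i - K
    · rw [Finset.sum_eq_zero, if_pos hl, if_neg (by omega)]
      · simp
      · intro k hk
        rw [Finset.mem_Icc] at hk
        exact if_neg (by omega)
    · by_cases hr : i + K < ⌊t / β⌋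
      · rw [Finset.sum_eq_zero, if_neg hl, if_pos hr]
        · simp
        · intro k hk
          rw [Finset.mem_Icc] at hk
          exact if_neg (by omega)
      · rw [Finset.sum_eq_single_of_mem (⌊t / β⌋ - i) (Finset.mem_Icc.2 (by omega))
          fun k _ hk => if_neg (by omega), if_pos (by ring), if_neg hl, if_neg hr]
        simp
  have hK1 : 1 ≤ K + 1 := by omega
  have hLz := ae_map_eq_zero_of_notMem_plus ha haβ hd hT hE hK1 (i := i) (f := indLp hL f) (by
    filter_upwards [coeFn_indLp hL f] with t ht h
    rw [ht, Set.indicator_of_notMem]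
    simp only [Set.mem_ofPred_eq]
    push_cast at h
    omega)
  have hRz := ae_map_eq_zero_of_notMem_minus ha haβ hd hE hK1 (i := i) (f := indLp hR f) (by
    filter_upwards [coeFn_indLp hR f] with t ht h
    rw [ht, Set.indicator_of_notMem]
    simp only [Set.mem_ofPred_eq]
    push_cast at h
    omega)
  have hTf := congrArg T hdec
  rw [map_add, map_add, map_sum] at hTf
  filter_upwards [hLz, hRz,
    Lp.coeFn_add (∑ k ∈ Finset.Icc (-(K : ℤ)) K, T (indLp (measurableSet_cell β (i + k)) f))
      (T (indLp hL f) + T (indLp hR f)),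
    Lp.coeFn_add (T (indLp hL f)) (T (indLp hR f)),
    Lp.coeFn_finsetSum (Finset.Icc (-(K : ℤ)) K)
      fun k => T (indLp (measurableSet_cell β (i + k)) f),
    ae_all_iff.2 fun k : ℤ => map_indLp_cell hT (i + k) f] with t h1 h2 h3 h4 h5 h6 hti
  rw [hTf, h3, Pi.add_apply, h4, Pi.add_apply, h5, h1 hti, h2 hti, add_zero, add_zero]
  · refine Finset.sum_congr rfl fun k _ => ?_
    rw [h6, walnutCoeff_of_mem_cell hti, moveTo_of_mem_cell hti, mul_comm]
    congr 3
    push_cast; ring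
  -- By `hK` the intervals for k = K + 1 are empty, so neither tail reaches cell i.
  · rintro n ⟨h7, h8⟩
    push_cast at h7 h8
    nlinarith
  · rintro n ⟨h7, h8⟩
    push_cast at h7 h8
    nlinarith

end Walnut

/-! ### The main theorem -/

theorem mainTheorem4 (g : Lp ℂ 2 (volume : Measure ℝ)) (a b c d : ℝ)
    (hcd : c < d) (hg : EssSuppSubset g (Set.Icc c d))
    (ha : a ∈ Set.Ico ((d - c) / 2) (d - c)) (hb : b ∈ Set.Ioo 0 (1 / a))
    (K : ℕ) (hK : K = ⌊(d - c - a) * b / (1 - a * b)⌋₊)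
    (hframe : IsFrame (gaborSystem g a b)) :
    ∃ S : Lp ℂ 2 (volume : Measure ℝ) ≃L[ℂ] Lp ℂ 2 (volume : Measure ℝ),
      IsFrameOperator (gaborSystem g a b) S ∧
      (∃ ω : ℤ → ℝ → ℂ,
        (∀ k : ℤ, MemLp (ω k) ∞ (volume : Measure ℝ)) ∧
        (∀ f : Lp ℂ 2 (volume : Measure ℝ),
          (S.symm f : ℝ → ℂ) =ᵐ[volume] fun t =>
            ∑ k ∈ Finset.Icc (-(K : ℤ)) K, ω k t * timeShift (-k * b⁻¹) f t) ∧
        ∀ k : ℕ, 1 ≤ k → k ≤ K →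
          EssSuppSubset (ω k) (⋃ n : ℤ, intervalMinus a b c d n k) ∧
          EssSuppSubset (ω (-k)) (⋃ n : ℤ, intervalPlus a b c d n k)) ∧
      EssSuppSubset (S.symm g)
        (Set.Icc c d ∪ ⋃ k ∈ Finset.Icc 1 K,
          (intervalMinus a b c d (-k) k ∪ intervalPlus a b c d k k)) := by
  obtain ⟨β, rfl⟩ : ∃ β : ℝ, b = β⁻¹ := ⟨b⁻¹, (inv_inv b).symm⟩
  obtain ⟨hb0, hb1⟩ := hb
  have hβ : 0 < β := inv_pos.1 hb0
  have ha0 : 0 < a := by linarith [ha.1]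
  have haβ : a < β := by
    rw [one_div] at hb1
    exact (inv_lt_inv₀ hβ ha0).1 hb1
  have hd : d - c ≤ 2 * a := by linarith [ha.1]
  have hK' : d - c - a < (K + 1) * (β - a) := by
    have h1 := Nat.lt_floor_add_one ((d - c - a) * β⁻¹ / (1 - a * β⁻¹))
    rw [← hK] at h1
    have h2 : (d - c - a) * β⁻¹ / (1 - a * β⁻¹) = (d - c - a) / (β - a) := by
      field_simp
    rw [h2] at h1
    exact (div_lt_iff₀ (sub_pos.2 haβ)).1 h1
  have : Fact (0 < β) := ⟨hβ⟩
  obtain ⟨S, hS⟩ := IsFrameOperator.exists_equiv hframe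
  obtain ⟨A, B, -, -, hAB⟩ := hframe
  have hB : IsBessel (gaborSystem g a β⁻¹) B := fun f => ⟨(hAB f).1, (hAB f).2.2⟩
  let T : Lp ℂ 2 (volume : Measure ℝ) →L[ℂ] Lp ℂ 2 (volume : Measure ℝ) := S.symm
  have hinv : ∀ V : Lp ℂ 2 (volume : Measure ℝ) →L[ℂ] Lp ℂ 2 (volume : Measure ℝ),
      (∀ f, (S : Lp ℂ 2 (volume : Measure ℝ) →L[ℂ] Lp ℂ 2 (volume : Measure ℝ)) (V f) =
        V ((S : Lp ℂ 2 (volume : Measure ℝ) →L[ℂ] Lp ℂ 2 (volume : Measure ℝ)) f)) →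
      ∀ f, T (V f) = V (T f) := by
    intro V hV f
    have h := hV (S.symm f)
    simp only [ContinuousLinearEquiv.coe_coe, ContinuousLinearEquiv.apply_symm_apply] at h
    change S.symm (V f) = V (S.symm f)
    rw [← h, ContinuousLinearEquiv.symm_apply_apply]
  have hT : ∀ (m : ℤ) f, T (mulLp (bddMeas_modChar (m * β⁻¹)) f) =
      mulLp (bddMeas_modChar (m * β⁻¹)) (T f) := fun m =>
    hinv _ (gabor_map_modChar hS m)
  have hE : ∀ l f, T (indLp (measurableSet_cutLeft a β c d l) f) =
      indLp (measurableSet_cutLeft a β c d l) (T f) := fun l =>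
    -- The windows are short enough for the cut sets: d - c ≤ 2a < 2β.
    hinv _ (gabor_map_indLp hg hB hS _ fun n => cutLeft_agrees hβ (by linarith) l n)
  have hrep := eq_sum_walnutCoeff ha0 haβ hd hT hE hK'
  refine ⟨S, hS, ⟨walnutCoeff β T, memLp_walnutCoeff hT, fun f => ?_, fun k hk _ => ⟨?_, ?_⟩⟩, ?_⟩
  · filter_upwards [hrep f] with t ht
    refine ht.trans (Finset.sum_congr rfl fun k _ => ?_)
    rw [timeShift, inv_inv, neg_mul, sub_neg_eq_add]
  · filter_upwards [essSupp_walnutCoeff ha0 haβ hd hE hk] with t ht hn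
    refine ht fun n h => hn (Set.mem_iUnion.2 ⟨n, ?_⟩)
    rwa [intervalMinus, inv_inv]
  · filter_upwards [essSupp_walnutCoeff_neg ha0 haβ hd hT hE hk] with t ht hn
    refine ht fun n h => hn (Set.mem_iUnion.2 ⟨n, ?_⟩)
    rwa [intervalPlus, inv_inv]
  · have hgs : ∀ k : ℤ, ∀ᵐ t : ℝ, t + k * β ∉ Set.Icc c d → g (t + k * β) = 0 := fun k =>
      (measurePreserving_add_right volume ((k : ℝ) * β)).quasiMeasurePreserving.ae hg
    have hm : ∀ k : ℕ, ∀ᵐ t : ℝ, 1 ≤ k →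
        (∀ n : ℤ, t ∉ Set.Icc (c + n * a) (d + ((k : ℝ) - 1) * a - k * β + n * a)) →
        walnutCoeff β T k t = 0 := by
      intro k
      by_cases hk : 1 ≤ k
      · filter_upwards [essSupp_walnutCoeff ha0 haβ hd hE hk] with t ht _ using ht
      · exact Filter.Eventually.of_forall fun t h => absurd h hk
    have hp : ∀ k : ℕ, ∀ᵐ t : ℝ, 1 ≤ k →
        (∀ n : ℤ, t ∉ Set.Icc (c - ((k : ℝ) - 1) * a + k * β + n * a) (d + n * a)) →
        walnutCoeff β T (-k) t = 0 := by
      intro k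
      by_cases hk : 1 ≤ k
      · filter_upwards [essSupp_walnutCoeff_neg ha0 haβ hd hT hE hk] with t ht _ using ht
      · exact Filter.Eventually.of_forall fun t h => absurd h hk
    filter_upwards [hrep g, ae_all_iff.2 hgs, ae_all_iff.2 hm, ae_all_iff.2 hp,
      ae_ne_lattice a β c] with t h1 h2 h3 h4 hN ht
    simp only [Set.mem_union, Set.mem_iUnion, Finset.mem_Icc, intervalMinus, intervalPlus,
      inv_inv, not_or, not_exists] at ht
    obtain ⟨ht0, htk⟩ := ht
    refine h1.trans (Finset.sum_eq_zero fun k hk => ?_)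
    rw [Finset.mem_Icc] at hk
    -- A nonzero k-th term needs both t + kβ in [c,d] and t in an interval carrying ω_k, which
    -- together put t in the claimed set.
    by_contra hne
    have hg' : t + k * β ∈ Set.Icc c d := by
      by_contra h
      exact hne (by rw [h2 k h, mul_zero])
    rcases lt_trichotomy k 0 with hneg | rfl | hpos
    · obtain ⟨j, rfl⟩ : ∃ j : ℕ, k = -j := ⟨k.natAbs, by omega⟩
      have hj : 1 ≤ j := by omega
      obtain ⟨n, hn⟩ : ∃ n : ℤ,
          t ∈ Set.Icc (c - ((j : ℝ) - 1) * a + j * β + n * a) (d + n * a) := by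
        by_contra h
        exact hne (by rw [h4 j hj (not_exists.1 h), zero_mul])
      push_cast at hg'
      rw [neg_mul, ← sub_eq_add_neg] at hg'
      rcases mem_of_mem_plus ha0 haβ hd hN hj hn hg' with h | ⟨l, hl, hlj, h⟩
      · exact ht0 h
      · exact (htk l ⟨hl, by omega⟩).2 (by exact_mod_cast h)
    · simp only [Int.cast_zero, zero_mul, add_zero] at hg'
      exact ht0 hg'
    · obtain ⟨j, rfl⟩ : ∃ j : ℕ, k = j := ⟨k.natAbs, by omega⟩
      have hj : 1 ≤ j := by omega
      obtain ⟨n, hn⟩ : ∃ n : ℤ,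
          t ∈ Set.Icc (c + n * a) (d + ((j : ℝ) - 1) * a - j * β + n * a) := by
        by_contra h
        exact hne (by rw [h3 j hj (not_exists.1 h), zero_mul])
      push_cast at hg'
      rcases mem_of_mem_minus ha0 haβ hd hN hj hn hg' with h | ⟨l, hl, hlj, h⟩
      · exact ht0 h
      · refine (htk l ⟨hl, by omega⟩).1 ?_
        push_cast
        exact ⟨by linarith [h.1], by linarith [h.2]⟩
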